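/- Let $X$ be a compact metric space and let $f:X\to X$ be a pointwise periodic homeomorphism, i.e. for every $x\in X$ there is an integer $n\ge 1$ with $f^n(x)=x$. Let $2^X$ be the set of nonempty closed subsets of $X$ with the Hausdorff metric, let $2^f:2^X\to 2^X$ be the induced map $2^f(A)=f(A)$, and let $A\in 2^X$. Write $\omega_{2^f}(A)=\bigcap_{n\in\mathbb{N}}\overline{\{(2^f)^k(A): k\ge n\}}$. Call a subset of $2^X$ minimal if it is nonempty, closed and invariant (mapped into itself by $2^f$) and no proper subset of it is nonempty, closed and invariant. Then: (i) $\omega_{2^f}(A)$ contains a unique minimal set $M$. (ii) $\omega_{2^f}(A)$ is finite if and only if $M$ is finite. (iii) If $\omega_{2^f}(A)$ is infinite, then $M$ is an adding machine: there are integers $j_1,j_2,\ldots\ge 2$ such that the restriction $2^f|_M$ is topologically conjugate to the map $x\mapsto x+(1,0,0,\ldots)$ on $\prod_{i\ge 1}\{0,\ldots,j_i-1\}$ (product of discrete spaces), where addition is coordinatewise modulo $j_i$ with carry from each coordinate to the next. -/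

import Mathlib

open Set Filter Topology TopologicalSpace

namespace HyperspaceDynamics

/-- Every point `x` satisfies `f^n x = x` for some `n ≥ 1`. -/
def PointwisePeriodic {X : Type*} (f : X → X) : Prop :=
  ∀ x, x ∈ Function.periodicPts f

/-- The induced map `2^f : 2^X → 2^X`, `A ↦ f(A)`. For a compact metric space `X`, the type
`NonemptyCompacts X` is the set of all nonempty closed subsets of `X`, and Mathlib's metric on it
is the Hausdorff metric. -/
def inducedMap {X : Type*} [TopologicalSpace X] (f : X → X) (hf : Continuous f) :
    NonemptyCompacts X → NonemptyCompacts X :=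
  NonemptyCompacts.map f hf

/-- The `ω`-limit set of the point `x` under iteration of `f`. -/
def omegaLimitSet {Y : Type*} [TopologicalSpace Y] (f : Y → Y) (x : Y) : Set Y :=
  omegaLimit atTop (fun (n : ℕ) (y : Y) => f^[n] y) {x}

theorem omegaLimitSet_eq_iInter {Y : Type*} [TopologicalSpace Y] (f : Y → Y) (x : Y) :
    omegaLimitSet f x = ⋂ n : ℕ, closure {y | ∃ k, n ≤ k ∧ f^[k] x = y} := by
  ext z
  simp only [omegaLimitSet, omegaLimit_def, image2_singleton_right, mem_iInter]
  constructor
  · intro h n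
    have := h (Ici n) (Ici_mem_atTop n)
    exact this
  · intro h u hu
    obtain ⟨n, hn⟩ := mem_atTop_sets.1 hu
    refine closure_mono ?_ (h n)
    rintro _ ⟨k, hk, rfl⟩
    exact ⟨k, hn k hk, rfl⟩

/-- `M` is nonempty, closed and invariant (`f(M) ⊆ M`). -/
structure IsClosedInvariant {Y : Type*} [TopologicalSpace Y] (f : Y → Y) (M : Set Y) : Prop where
  nonempty : M.Nonempty
  isClosed : IsClosed M
  mapsTo : MapsTo f M M

/-- Minimal sets: nonempty closed invariant sets no proper subset of which is nonempty, closed and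
invariant. -/
def IsMinimalSet {Y : Type*} [TopologicalSpace Y] (f : Y → Y) (M : Set Y) : Prop :=
  IsClosedInvariant f M ∧ ∀ N : Set Y, N ⊆ M → IsClosedInvariant f N → N = M

/-- Topological conjugacy of two dynamical systems. -/
def Conjugate {Y Z : Type*} [TopologicalSpace Y] [TopologicalSpace Z]
    (f : Y → Y) (g : Z → Z) : Prop :=
  ∃ h : Y ≃ₜ Z, Function.Semiconj h f g

/-- The space of all sequences `x` with `x i ∈ {0, …, j i - 1}`, with the product topology of the
discrete topologies. -/
abbrev DigitSpace (j : ℕ → ℕ) : Type := ∀ i : ℕ, Fin (j i)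

/-- `carry x y i` is the digit carried into position `i` when adding `x` and `y`. -/
def carry {j : ℕ → ℕ} (x y : DigitSpace j) : ℕ → ℕ
  | 0 => 0
  | i + 1 => if (x i : ℕ) + (y i : ℕ) + carry x y i < j i then 0 else 1

/-- Addition of digit sequences with carry to the right. -/
def digitAdd {j : ℕ → ℕ} (hj : ∀ i, 2 ≤ j i) (x y : DigitSpace j) : DigitSpace j :=
  fun i => ⟨((x i : ℕ) + (y i : ℕ) + carry x y i) % j i,
    Nat.mod_lt _ (lt_of_lt_of_le Nat.zero_lt_two (hj i))⟩

/-- The sequence `(1, 0, 0, …)`. -/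
def digitOne {j : ℕ → ℕ} (hj : ∀ i, 2 ≤ j i) : DigitSpace j :=
  fun i => ⟨if i = 0 then 1 else 0, by have := hj i; split_ifs <;> omega⟩

/-- The adding machine map `x ↦ x + (1, 0, 0, …)`. -/
def addingMachine {j : ℕ → ℕ} (hj : ∀ i, 2 ≤ j i) (x : DigitSpace j) : DigitSpace j :=
  digitAdd hj x (digitOne hj)

/-- A closed invariant set `M` is an adding machine if the restriction of `f` to `M` is conjugate
to the adding machine map of some sequence of integers `j i ≥ 2`. -/
def IsAddingMachine {Y : Type*} [TopologicalSpace Y] (f : Y → Y) (M : Set Y) : Prop :=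
  IsClosed M ∧ ∃ hM : MapsTo f M M, ∃ (j : ℕ → ℕ) (hj : ∀ i, 2 ≤ j i),
    Conjugate (hM.restrict f M M) (addingMachine hj)

end HyperspaceDynamics

/-!
Let `F = 2^f`. The proof looks at the iterates `F^k` as `k` tends to `0` in the profinite topology
of `ℕ`, that is, along the filter `profiniteZero` generated by the sets of multiples of `n !`.

Every point of `A` is periodic, so it lies in `f^k(A)` for all `k` divisible by its period. Hence
each cluster point of `F^k(A)` along `profiniteZero` contains `A`
(`PointwisePeriodic.le_of_mapClusterPt`). Inside a minimal set of `F` the relation "`C` is a cluster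
point of `F^k(B)` along `profiniteZero`" is symmetric, since the minimal sets of each `F^n` partition
it (`IsMinimalSet.mapClusterPt_symm`). Two elements so related contain each other, and therefore
are equal (`IsMinimalSet.eq_of_mapClusterPt`).

*Adding machine.* Let `M` be an infinite minimal set of `F`. A minimal set `E ⊆ M` of some `F^n`
(a cell) has finitely many images `F^j(E)`, which are clopen and partition `M`, and the index of the
image that contains a point is a factor map of `M` onto a finite cyclic group. Distinct points of
`M` are separated by cells because cluster points along `profiniteZero` are trivial, so a decreasing
sequence of cells gives compatible and jointly injective factor maps, whose mixed radix digits form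
the conjugacy (`conjugate_addingMachine`, `isAddingMachine_of_infinite`).

*Uniqueness.* Every minimal set in the `ω`-limit set of `A` contains a cluster point of `F^k(A)`
along `profiniteZero` (`IsMinimalSet.exists_mapClusterPt`). Let `B` and `B'` be such points of two
minimal sets. Then `A ⊆ B`, and `F^k(B) → B` along `profiniteZero`, so `B' ⊆ B`
(`IsMinimalSet.le_of_mapClusterPt_of_le`). By symmetry `B = B'`, and minimal sets that meet are
equal.

*Finiteness.* If `M` is finite, then `B` is periodic under `F`. By the Baire category theorem some
power of `f` is the identity near the points of a dense open subset of `B`, and this forces `A` to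
be dense in `B` (`PointwisePeriodic.eq_of_mapClusterPt_of_iterate_eq`). So `A = B` is periodic, and
its `ω`-limit set is its orbit.
-/

namespace HyperspaceDynamics

/-! ### Minimal sets of a map and of its iterates -/

section Minimal

theorem image_iterate_add {Y : Type*} (F : Y → Y) (i j : ℕ) (E : Set Y) :
    F^[i + j] '' E = F^[i] '' (F^[j] '' E) := by
  rw [Function.iterate_add, image_comp]

theorem image_iterate_mul {Y : Type*} {F : Y → Y} {p : ℕ} {E : Set Y} (h : F^[p] '' E = E) (m : ℕ) :
    F^[p * m] '' E = E := by
  induction m with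
  | zero => simp
  | succ m ih => rw [Nat.mul_succ, image_iterate_add, h, ih]

variable {Y : Type*} [TopologicalSpace Y] {F : Y → Y} {M : Set Y}

theorem IsClosedInvariant.exists_isMinimalSet [CompactSpace Y] (hM : IsClosedInvariant F M) :
    ∃ N ⊆ M, IsMinimalSet F N := by
  obtain ⟨N, hNM, hN⟩ := zorn_superset_nonempty {N | IsClosedInvariant F N} (by
    intro c hc hchain hne
    refine ⟨⋂₀ c, ⟨?_, isClosed_sInter fun s hs => (hc hs).isClosed, ?_⟩,
      fun s hs => sInter_subset_of_mem hs⟩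
    · have := hne.to_subtype
      rw [sInter_eq_iInter]
      refine IsCompact.nonempty_iInter_of_directed_nonempty_isCompact_isClosed _ ?_
        (fun s => (hc s.2).nonempty) (fun s => (hc s.2).isClosed.isCompact)
        (fun s => (hc s.2).isClosed)
      intro s t
      rcases hchain.total s.2 t.2 with h | h
      · exact ⟨s, subset_rfl, h⟩
      · exact ⟨t, h, subset_rfl⟩
    · exact fun x hx s hs => (hc hs).mapsTo (hx s hs)) M hM
  exact ⟨N, hNM, hN.prop, fun N' h h' => h.antisymm (hN.le_of_le h' h)⟩

theorem IsMinimalSet.subset_of_mem (hM : IsMinimalSet F M) {S : Set Y} (hS : IsClosed S)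
    (hSF : MapsTo F S S) {x : Y} (hxM : x ∈ M) (hxS : x ∈ S) : M ⊆ S :=
  inter_eq_left.1 <| hM.2 (M ∩ S) inter_subset_left
    ⟨⟨x, hxM, hxS⟩, hM.1.isClosed.inter hS, hM.1.mapsTo.inter_inter hSF⟩

theorem IsMinimalSet.eq_of_mem {N : Set Y} (hM : IsMinimalSet F M) (hN : IsMinimalSet F N) {x : Y}
    (hxM : x ∈ M) (hxN : x ∈ N) : M = N :=
  (hM.subset_of_mem hN.1.isClosed hN.1.mapsTo hxM hxN).antisymm
    (hN.subset_of_mem hM.1.isClosed hM.1.mapsTo hxN hxM)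

/-- The orbit of every point of a minimal set is dense in it. -/
theorem IsMinimalSet.subset_closure_orbit (hF : Continuous F) (hM : IsMinimalSet F M) {x : Y}
    (hx : x ∈ M) : M ⊆ closure (range fun k => F^[k] x) := by
  refine hM.subset_of_mem isClosed_closure ?_ hx (subset_closure ⟨0, rfl⟩)
  refine MapsTo.closure ?_ hF
  rintro _ ⟨k, rfl⟩
  exact ⟨k + 1, Function.iterate_succ_apply' F k x⟩

variable [CompactSpace Y] [T2Space Y]

/-- A continuous map commuting with `G` carries minimal sets of `G` to minimal sets of `G`. -/
theorem IsMinimalSet.image {G : Y → Y} (hF : Continuous F) (hFG : Function.Commute F G)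
    {E : Set Y} (hE : IsMinimalSet G E) : IsMinimalSet G (F '' E) := by
  refine ⟨⟨hE.1.nonempty.image F, (hE.1.isClosed.isCompact.image hF).isClosed, ?_⟩, ?_⟩
  · rintro _ ⟨x, hx, rfl⟩
    exact ⟨G x, hE.1.mapsTo hx, hFG x⟩
  · intro N hNE hN
    obtain ⟨y, hy⟩ := hN.nonempty
    obtain ⟨x, hx, rfl⟩ := hNE hy
    refine hNE.antisymm (image_subset_iff.2 ?_)
    refine hE.subset_of_mem (hN.isClosed.preimage hF) (fun z hz => ?_) hx hy
    have := hN.mapsTo hz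
    rwa [← hFG z] at this

theorem IsMinimalSet.iterate_image {n : ℕ} (hF : Continuous F) {E : Set Y}
    (hE : IsMinimalSet F^[n] E) (j : ℕ) : IsMinimalSet F^[n] (F^[j] '' E) :=
  hE.image (hF.iterate j) (Function.Commute.iterate_iterate_self F j n)

theorem IsMinimalSet.image_eq (hF : Continuous F) (hM : IsMinimalSet F M) : F '' M = M :=
  hM.2 _ hM.1.mapsTo.image_subset (hM.image hF (Function.Commute.refl F)).1

/-- The first `n` images of a minimal set `E` of `F^n` cover any minimal set of `F` containing
`E`: their union is closed, and it is invariant because `F^n(E) = E`. -/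
theorem IsMinimalSet.exists_mem_iterate_image (hF : Continuous F) (hM : IsMinimalSet F M) {n : ℕ}
    (hn : 1 ≤ n) {E : Set Y} (hEM : E ⊆ M) (hE : IsMinimalSet F^[n] E) {x : Y} (hx : x ∈ M) :
    ∃ j < n, x ∈ F^[j] '' E := by
  have hclosed : IsClosed (⋃ j ∈ Iio n, F^[j] '' E) :=
    (finite_Iio n).isClosed_biUnion fun j _ => (hE.iterate_image hF j).1.isClosed
  have hmaps : MapsTo F (⋃ j ∈ Iio n, F^[j] '' E) (⋃ j ∈ Iio n, F^[j] '' E) := by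
    intro y hy
    simp only [mem_iUnion, mem_Iio, exists_prop] at hy ⊢
    obtain ⟨j, hj, z, hz, rfl⟩ := hy
    have hmem : F (F^[j] z) ∈ F^[j + 1] '' E := ⟨z, hz, Function.iterate_succ_apply' F j z⟩
    rcases Nat.lt_or_ge (j + 1) n with h | h
    · exact ⟨j + 1, h, hmem⟩
    · obtain rfl : j + 1 = n := by omega
      rw [hE.image_eq (hF.iterate _)] at hmem
      exact ⟨0, hn, by simpa using hmem⟩
  obtain ⟨e, he⟩ := hE.1.nonempty
  have he' : e ∈ ⋃ j ∈ Iio n, F^[j] '' E := by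
    simp only [mem_iUnion, mem_Iio, exists_prop]
    exact ⟨0, hn, by simpa using he⟩
  simpa using hM.subset_of_mem hclosed hmaps (hEM he) he' hx

/-- Every point of a minimal set of `F` lies in a minimal set of `F^n`. -/
theorem IsMinimalSet.exists_isMinimalSet_iterate (hF : Continuous F) (hM : IsMinimalSet F M)
    {n : ℕ} (hn : 1 ≤ n) {x : Y} (hx : x ∈ M) : ∃ E ⊆ M, x ∈ E ∧ IsMinimalSet F^[n] E := by
  obtain ⟨E, hEM, hE⟩ := IsClosedInvariant.exists_isMinimalSet (F := F^[n]) (M := M)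
    ⟨hM.1.nonempty, hM.1.isClosed, hM.1.mapsTo.iterate n⟩
  obtain ⟨j, -, hxj⟩ := hM.exists_mem_iterate_image hF hn hEM hE hx
  exact ⟨_, (image_mono hEM).trans (hM.1.mapsTo.iterate j).image_subset, hxj,
    hE.iterate_image hF j⟩

end Minimal

/-! ### Return time and phase of a cell -/

section Phase

variable {Y : Type*} [TopologicalSpace Y] {F : Y → Y} {M E : Set Y} {n : ℕ}

/-- The least `m ≥ 1` with `F^m(E) = E`. When `E` is a minimal set of some `F^n`, the sets
`F^j(E)` with `j < returnTime F E` are pairwise disjoint. -/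
noncomputable def returnTime (F : Y → Y) (E : Set Y) : ℕ :=
  sInf {m | 0 < m ∧ F^[m] '' E = E}

/-- The least `j` with `x ∈ F^j(E)`; it is `0` if there is none. -/
noncomputable def phase (F : Y → Y) (E : Set Y) (x : Y) : ℕ :=
  sInf {j | x ∈ F^[j] '' E}

variable [CompactSpace Y] [T2Space Y]

theorem returnTime_spec (hF : Continuous F) (hn : 1 ≤ n) (hE : IsMinimalSet F^[n] E) :
    0 < returnTime F E ∧ F^[returnTime F E] '' E = E :=
  Nat.sInf_mem (s := {m | 0 < m ∧ F^[m] '' E = E}) ⟨n, hn, hE.image_eq (hF.iterate n)⟩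

theorem image_iterate_eq_self_iff (hF : Continuous F) (hn : 1 ≤ n) (hE : IsMinimalSet F^[n] E)
    (m : ℕ) : F^[m] '' E = E ↔ returnTime F E ∣ m := by
  obtain ⟨hpos, hret⟩ := returnTime_spec hF hn hE
  refine ⟨fun h => ?_, fun ⟨c, hc⟩ => hc ▸ image_iterate_mul hret c⟩
  rw [← Nat.mod_add_div m (returnTime F E), image_iterate_add, image_iterate_mul hret] at h
  refine Nat.dvd_of_mod_eq_zero (Nat.eq_zero_of_not_pos fun hlt => ?_)
  have hle : returnTime F E ≤ m % returnTime F E := Nat.sInf_le ⟨hlt, h⟩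
  exact absurd (Nat.mod_lt m hpos) (not_lt.2 hle)

/-- Two images of the cell `E` that meet are equal, and then their exponents agree modulo the
return time. -/
theorem modEq_of_mem_iterate_image (hF : Continuous F) (hn : 1 ≤ n) (hE : IsMinimalSet F^[n] E)
    {i j : ℕ} {x : Y} (hi : x ∈ F^[i] '' E) (hj : x ∈ F^[j] '' E) :
    i ≡ j [MOD returnTime F E] := by
  wlog hij : i ≤ j generalizing i j
  · exact (this hj hi (le_of_not_ge hij)).symm
  have heq := (hE.iterate_image hF i).eq_of_mem (hE.iterate_image hF j) hi hj
  have hret := hE.image_eq (hF.iterate n)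
  rw [Nat.modEq_iff_dvd' hij, ← image_iterate_eq_self_iff hF hn hE]
  -- Push the equality `F^i(E) = F^j(E)` forward until the left side is `F^(n i)(E) = E`.
  have h2 := congrArg (F^[n * i - i] '' ·) heq
  have hni : i ≤ n * i := Nat.le_mul_of_pos_left i hn
  simp only [← image_iterate_add] at h2
  rw [show n * i - i + i = n * i by omega, show n * i - i + j = (j - i) + n * i by omega,
    image_iterate_add F (j - i), image_iterate_mul hret] at h2
  exact h2.symm

theorem mem_image_phase (hF : Continuous F) (hM : IsMinimalSet F M) (hn : 1 ≤ n) (hEM : E ⊆ M)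
    (hE : IsMinimalSet F^[n] E) {x : Y} (hx : x ∈ M) : x ∈ F^[phase F E x] '' E := by
  obtain ⟨j, -, hj⟩ := hM.exists_mem_iterate_image hF hn hEM hE hx
  exact Nat.sInf_mem (s := {j | x ∈ F^[j] '' E}) ⟨j, hj⟩

theorem mem_image_iterate_iff (hF : Continuous F) (hM : IsMinimalSet F M) (hn : 1 ≤ n)
    (hEM : E ⊆ M) (hE : IsMinimalSet F^[n] E) {x : Y} (hx : x ∈ M) (j : ℕ) :
    x ∈ F^[j] '' E ↔ j ≡ phase F E x [MOD returnTime F E] := by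
  have hph := mem_image_phase hF hM hn hEM hE hx
  refine ⟨fun h => modEq_of_mem_iterate_image hF hn hE h hph, fun h => ?_⟩
  have hret := (returnTime_spec hF hn hE).2
  have key : ∀ i, F^[i] '' E = F^[i % returnTime F E] '' E := fun i => by
    conv_lhs => rw [← Nat.mod_add_div i (returnTime F E), image_iterate_add,
      image_iterate_mul hret]
  rw [key, h, ← key]
  exact hph

theorem phase_lt (hF : Continuous F) (hM : IsMinimalSet F M) (hn : 1 ≤ n)
    (hEM : E ⊆ M) (hE : IsMinimalSet F^[n] E) {x : Y} (hx : x ∈ M) :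
    phase F E x < returnTime F E := by
  refine lt_of_le_of_lt (Nat.sInf_le ?_)
    (Nat.mod_lt (phase F E x) (returnTime_spec hF hn hE).1)
  exact (mem_image_iterate_iff hF hM hn hEM hE hx _).2 (Nat.mod_modEq _ _)

theorem phase_eq_iff (hF : Continuous F) (hM : IsMinimalSet F M) (hn : 1 ≤ n)
    (hEM : E ⊆ M) (hE : IsMinimalSet F^[n] E) {x : Y} (hx : x ∈ M) {j : ℕ}
    (hj : j < returnTime F E) : phase F E x = j ↔ x ∈ F^[j] '' E := by
  rw [mem_image_iterate_iff hF hM hn hEM hE hx]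
  refine ⟨fun h => h ▸ Nat.ModEq.refl _, fun h => ?_⟩
  exact (h.eq_of_lt_of_lt hj (phase_lt hF hM hn hEM hE hx)).symm

theorem phase_map (hF : Continuous F) (hM : IsMinimalSet F M) (hn : 1 ≤ n)
    (hEM : E ⊆ M) (hE : IsMinimalSet F^[n] E) {x : Y} (hx : x ∈ M) :
    phase F E (F x) = (phase F E x + 1) % returnTime F E := by
  rw [phase_eq_iff hF hM hn hEM hE (hM.1.mapsTo hx)
    (Nat.mod_lt _ (returnTime_spec hF hn hE).1),
    mem_image_iterate_iff hF hM hn hEM hE (hM.1.mapsTo hx)]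
  refine (Nat.mod_modEq _ _).trans ?_
  rw [← mem_image_iterate_iff hF hM hn hEM hE (hM.1.mapsTo hx), Nat.add_comm, image_iterate_add]
  exact ⟨x, mem_image_phase hF hM hn hEM hE hx, rfl⟩

theorem returnTime_dvd_of_subset (hF : Continuous F) (hn : 1 ≤ n) (hE : IsMinimalSet F^[n] E)
    {n' : ℕ} (hn' : 1 ≤ n') {E' : Set Y} (hE' : IsMinimalSet F^[n'] E') (hEE : E' ⊆ E) :
    returnTime F E ∣ returnTime F E' := by
  obtain ⟨e, he⟩ := hE'.1.nonempty
  have he' : e ∈ F^[returnTime F E'] '' E' := (returnTime_spec hF hn' hE').2.symm ▸ he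
  have h0 : e ∈ F^[0] '' E := by simpa using hEE he
  exact (Nat.modEq_zero_iff_dvd).1
    (modEq_of_mem_iterate_image hF hn hE (image_mono hEE he') h0)

theorem phase_mod_of_subset (hF : Continuous F) (hM : IsMinimalSet F M) (hn : 1 ≤ n)
    (hEM : E ⊆ M) (hE : IsMinimalSet F^[n] E) {n' : ℕ} (hn' : 1 ≤ n') {E' : Set Y}
    (hE' : IsMinimalSet F^[n'] E') (hEE : E' ⊆ E) {x : Y} (hx : x ∈ M) :
    phase F E' x % returnTime F E = phase F E x := by
  have h := image_mono hEE (mem_image_phase hF hM hn' (hEE.trans hEM) hE' hx)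
  have h' := (mem_image_iterate_iff hF hM hn hEM hE hx _).1 h
  rw [h', Nat.mod_eq_of_lt (phase_lt hF hM hn hEM hE hx)]

end Phase

/-! ### A criterion for conjugacy with an adding machine -/

section Criterion

/-- Adding `1` to a digit sequence: if `p i` is the number with digits `x 0, …, x (i - 1)` in the
mixed radix system with place values `D i`, then the carry into position `i`, together with the
digit `1` added in position `0`, is `1` exactly when `p i` is the largest number with `i`
digits. -/
theorem carry_digitOne {j : ℕ → ℕ} (hj : ∀ i, 2 ≤ j i) {D : ℕ → ℕ} (hD0 : D 0 = 1)
    (hD : ∀ i, D (i + 1) = D i * j i) (x : DigitSpace j) {p : ℕ → ℕ} (hp : ∀ i, p i < D i)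
    (hpx : ∀ i, p (i + 1) = p i + D i * (x i : ℕ)) (i : ℕ) :
    (digitOne hj i : ℕ) + carry x (digitOne hj) i = if p i + 1 = D i then 1 else 0 := by
  induction i with
  | zero =>
    have := hp 0
    simp [digitOne, carry, hD0] at this ⊢
    omega
  | succ i ih =>
    have hlt := (x i).2
    have hpi := hp i
    have hpos : 0 < D i := by omega
    rw [carry, Nat.add_assoc (x i : ℕ), ih, hpx, hD]
    have h0 : (digitOne hj (i + 1) : ℕ) = 0 := by simp [digitOne]
    rw [h0, Nat.zero_add]
    by_cases hx : (x i : ℕ) + 1 = j i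
    · have hle : D i * j i = D i * (x i : ℕ) + D i := by
        conv_lhs => rw [← hx]
        rw [Nat.mul_succ]
      split_ifs <;> omega
    · have hle : D i * ((x i : ℕ) + 2) ≤ D i * j i := Nat.mul_le_mul_left _ (by omega)
      rw [Nat.mul_add] at hle
      split_ifs <;> omega

/-- A system with compatible, jointly injective factor maps `φ i` onto the cyclic groups of
orders `D i` is conjugate to the adding machine with `j i = D (i + 1) / D i`. The conjugacy sends
`x` to the sequence of the digits of the numbers `φ i x` in the mixed radix system with place
values `D i`. -/
theorem conjugate_addingMachine {Z : Type*} [TopologicalSpace Z] [CompactSpace Z] [Nonempty Z]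
    {F : Z → Z} {j : ℕ → ℕ} (hj : ∀ i, 2 ≤ j i) {D : ℕ → ℕ} (hD0 : D 0 = 1)
    (hD : ∀ i, D (i + 1) = D i * j i) (φ : ℕ → Z → ℕ) (hlt : ∀ i x, φ i x < D i)
    (hstep : ∀ i x, φ i (F x) = (φ i x + 1) % D i)
    (hcompat : ∀ i x, φ (i + 1) x % D i = φ i x)
    (hclosed : ∀ i c, IsClosed {x | φ i x = c})
    (hsep : ∀ x y, (∀ i, φ i x = φ i y) → x = y) :
    Conjugate F (addingMachine hj) := by
  have hpos : ∀ i, 0 < D i := fun i => by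
    induction i with
    | zero => simp [hD0]
    | succ i ih => rw [hD]; exact Nat.mul_pos ih (by have := hj i; omega)
  have hdig : ∀ x i, φ (i + 1) x / D i < j i := fun x i =>
    Nat.div_lt_of_lt_mul (hD i ▸ hlt (i + 1) x)
  let h : Z → DigitSpace j := fun x i => ⟨φ (i + 1) x / D i, hdig x i⟩
  have hrec : ∀ x i, φ (i + 1) x = φ i x + D i * (h x i : ℕ) := fun x i => by
    have := Nat.mod_add_div (φ (i + 1) x) (D i)
    rw [hcompat] at this
    exact this.symm
  have hzero : ∀ x, φ 0 x = 0 := fun x => by have := hlt 0 x; omega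
  have hcont : Continuous h := by
    refine continuous_pi fun i => continuous_iff_isClosed.2 fun s _ => ?_
    have : (fun x => h x i) ⁻¹' s =
        ⋃ c ∈ {c | c < D (i + 1) ∧ ∃ d ∈ s, (d : ℕ) = c / D i}, {x | φ (i + 1) x = c} := by
      ext x
      simp only [mem_preimage, mem_iUnion, mem_ofPred_eq, exists_prop]
      constructor
      · exact fun hx => ⟨_, ⟨hlt _ x, _, hx, rfl⟩, rfl⟩
      · rintro ⟨c, ⟨-, d, hd, hdc⟩, rfl⟩
        have : h x i = d := Fin.ext hdc.symm
        rwa [this]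
    rw [this]
    exact ((finite_lt_nat (D (i + 1))).subset fun c hc => hc.1).isClosed_biUnion
      fun c _ => hclosed _ c
  have hinj : Function.Injective h := by
    intro x y hxy
    refine hsep x y fun i => ?_
    induction i with
    | zero => rw [hzero, hzero]
    | succ i ih => rw [hrec, hrec, ih, hxy]
  have hsurj : Function.Surjective h := by
    intro a
    let N : ℕ → ℕ := fun i => Nat.rec 0 (fun i s => s + D i * (a i : ℕ)) i
    have hN : ∀ i, N (i + 1) = N i + D i * (a i : ℕ) := fun i => rfl
    have hNlt : ∀ i, N i < D i := fun i => by
      induction i with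
      | zero => rw [hD0]; exact Nat.one_pos
      | succ i ih =>
        have : D i * ((a i : ℕ) + 1) ≤ D i * j i := Nat.mul_le_mul_left _ (a i).2
        rw [hN, hD]
        rw [Nat.mul_succ] at this
        omega
    obtain ⟨x, hx⟩ : (⋂ i, {x | φ i x = N i}).Nonempty := by
      refine IsCompact.nonempty_iInter_of_sequence_nonempty_isCompact_isClosed _ ?_ ?_
        (hclosed 0 _).isCompact (fun i => hclosed i _)
      · intro i x hx
        have hx : φ (i + 1) x = N (i + 1) := hx
        change φ i x = N i
        rw [← hcompat, hx, hN, Nat.add_mul_mod_self_left, Nat.mod_eq_of_lt (hNlt i)]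
      · intro i
        obtain ⟨z⟩ := ‹Nonempty Z›
        have hit : ∀ k, φ i (F^[k] z) = (φ i z + k) % D i := fun k => by
          induction k with
          | zero => exact (Nat.mod_eq_of_lt (hlt i z)).symm
          | succ k ih =>
            rw [Function.iterate_succ_apply', hstep, ih, Nat.mod_add_mod, Nat.add_assoc]
        refine ⟨F^[D i - φ i z + N i] z, ?_⟩
        have := hlt i z
        rw [mem_ofPred_eq, hit, show φ i z + (D i - φ i z + N i) = N i + D i by omega,
          Nat.add_mod_right, Nat.mod_eq_of_lt (hNlt i)]
    refine ⟨x, funext fun i => Fin.ext ?_⟩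
    change φ (i + 1) x / D i = a i
    have hx : ∀ i, φ i x = N i := fun i => mem_iInter.1 hx i
    rw [hx, hN, Nat.add_mul_div_left _ _ (hpos i), Nat.div_eq_of_lt (hNlt i), Nat.zero_add]
  have hsemi : Function.Semiconj h F (addingMachine hj) := by
    intro x
    refine funext fun i => Fin.ext ?_
    change φ (i + 1) (F x) / D i = ((h x i : ℕ) + (digitOne hj i : ℕ) + carry (h x) _ i) % j i
    rw [Nat.add_assoc, carry_digitOne hj hD0 hD (h x) (hlt · x) (hrec x), hstep, hD, mul_comm (D i),
      Nat.mod_mul_left_div_self, hrec, Nat.add_right_comm, Nat.add_mul_div_left _ _ (hpos i),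
      Nat.add_comm (_ / _)]
    congr 2
    have := hlt i x
    split_ifs with hc
    · rw [hc, Nat.div_self (hpos i)]
    · exact Nat.div_eq_of_lt (by omega)
  exact ⟨Continuous.homeoOfEquivCompactToT2 (f := Equiv.ofBijective h ⟨hinj, hsurj⟩) hcont, hsemi⟩

end Criterion

/-! ### Infinite minimal sets with trivial cluster points at the profinite zero -/

section ProfiniteZero

/-- The filter of neighbourhoods of `0` in `ℕ` for the profinite topology: a set belongs to it if
it contains all multiples of some `n !` (equivalently, all multiples of some `n ≥ 1`). -/
def profiniteZero : Filter ℕ := ⨅ n : ℕ, 𝓟 {k | n.factorial ∣ k}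

theorem hasBasis_profiniteZero :
    profiniteZero.HasBasis (fun _ : ℕ => True) fun n => {k | n.factorial ∣ k} :=
  hasBasis_iInf_principal <| directed_of_isDirected_le fun _ _ hmn _ hk =>
    (Nat.factorial_dvd_factorial hmn).trans hk

instance : profiniteZero.NeBot :=
  hasBasis_profiniteZero.neBot_iff.2 fun _ => ⟨0, dvd_zero _⟩

theorem eventually_dvd_profiniteZero {n : ℕ} (hn : 1 ≤ n) : ∀ᶠ k in profiniteZero, n ∣ k :=
  hasBasis_profiniteZero.mem_of_superset (i := n) trivial fun _ hk =>
    (Nat.dvd_factorial hn le_rfl).trans hk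

variable {Y : Type*} [TopologicalSpace Y] {F : Y → Y}

theorem mapClusterPt_profiniteZero_iff {x y : Y} :
    MapClusterPt y profiniteZero (fun k => F^[k] x) ↔
      ∀ n, 1 ≤ n → y ∈ closure (range fun k => F^[n * k] x) := by
  have hB := hasBasis_profiniteZero.map fun k => F^[k] x
  rw [MapClusterPt, hB.clusterPt_iff_forall_mem_closure]
  constructor
  · intro h n hn
    refine closure_mono ?_ (h n trivial)
    rintro _ ⟨k, hk, rfl⟩
    obtain ⟨c, rfl⟩ := (Nat.dvd_factorial hn le_rfl).trans hk
    exact ⟨c, rfl⟩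
  · intro h n _
    refine closure_mono ?_ (h _ n.factorial_pos)
    rintro _ ⟨k, rfl⟩
    exact ⟨_, dvd_mul_right _ _, rfl⟩

theorem IsMinimalSet.subset_closure_iterate {E : Set Y} {n : ℕ} (hF : Continuous F)
    (hE : IsMinimalSet F^[n] E) {x : Y} (hx : x ∈ E) :
    E ⊆ closure (range fun k => F^[n * k] x) := by
  simp only [Function.iterate_mul]
  exact hE.subset_closure_orbit (hF.iterate n) hx

/-- In a minimal set, the relation "`y` is a cluster point of `F^k(x)` as `k` tends to `0`
profinitely" is symmetric, because the minimal sets of `F^n` form a partition. -/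
theorem IsMinimalSet.mapClusterPt_symm [CompactSpace Y] [T2Space Y] {M : Set Y}
    (hF : Continuous F) (hM : IsMinimalSet F M) {x y : Y} (hx : x ∈ M)
    (h : MapClusterPt y profiniteZero (fun k => F^[k] x)) :
    y ∈ M ∧ MapClusterPt x profiniteZero (fun k => F^[k] y) := by
  rw [mapClusterPt_profiniteZero_iff] at h ⊢
  have key : ∀ n, 1 ≤ n → ∃ E ⊆ M, x ∈ E ∧ y ∈ E ∧ IsMinimalSet F^[n] E := by
    intro n hn
    obtain ⟨E, hEM, hxE, hE⟩ := hM.exists_isMinimalSet_iterate hF hn hx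
    refine ⟨E, hEM, hxE, closure_minimal ?_ hE.1.isClosed (h n hn), hE⟩
    rintro _ ⟨k, rfl⟩
    simp only [Function.iterate_mul]
    exact hE.1.mapsTo.iterate k hxE
  refine ⟨?_, fun n hn => ?_⟩
  · obtain ⟨E, hEM, -, hy, -⟩ := key 1 le_rfl
    exact hEM hy
  · obtain ⟨E, -, hxE, hyE, hE⟩ := key n hn
    exact hE.subset_closure_iterate hF hyE hxE

variable [CompactSpace Y] [T2Space Y] {M : Set Y}

/-- In an infinite minimal set with trivial cluster points, every cell contains a strictly smaller
cell, with a strictly larger return time, whose exponent is divisible by a given `m`. -/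
theorem exists_finer_cell (hF : Continuous F) (hM : IsMinimalSet F M) (hinf : M.Infinite)
    (hsep : ∀ x ∈ M, ∀ y ∈ M, MapClusterPt y profiniteZero (fun k => F^[k] x) → y = x)
    {n : ℕ} (hn : 1 ≤ n) {E : Set Y} (hEM : E ⊆ M) (hE : IsMinimalSet F^[n] E) {m : ℕ}
    (hm : 1 ≤ m) :
    ∃ n' E', 1 ≤ n' ∧ m ∣ n' ∧ E' ⊆ E ∧ IsMinimalSet F^[n'] E' ∧
      returnTime F E < returnTime F E' := by
  obtain ⟨x, hx, y, hy, hxy⟩ : ∃ x ∈ E, ∃ y ∈ E, y ≠ x := by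
    by_contra! hcon
    have hfin : E.Finite := Set.Subsingleton.finite fun a ha b hb => hcon b hb a ha
    refine hinf (((finite_Iio n).biUnion fun j _ => hfin.image F^[j]).subset fun z hz => ?_)
    simpa using hM.exists_mem_iterate_image hF hn hEM hE hz
  have hncl := mt (hsep x (hEM hx) y (hEM hy)) hxy
  rw [mapClusterPt_profiniteZero_iff] at hncl
  push Not at hncl
  obtain ⟨p, hp, hyp⟩ := hncl
  have hn' : 1 ≤ n * (p * m) := Nat.mul_pos hn (Nat.mul_pos hp hm)
  obtain ⟨E', hE'M, hxE', hE'⟩ := hM.exists_isMinimalSet_iterate hF hn' (hEM hx)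
  have hE'E : E' ⊆ E := hE'.subset_of_mem hE.1.isClosed
    (by rw [Function.iterate_mul]; exact hE.1.mapsTo.iterate _) hxE' hx
  have hyE' : y ∉ E' := fun h => hyp <| by
    refine closure_mono ?_ (hE'.subset_closure_iterate hF hxE' h)
    rintro _ ⟨k, rfl⟩
    exact ⟨n * m * k, by ring_nf⟩
  refine ⟨_, E', hn', Dvd.intro_left (n * p) (by ring), hE'E, hE', ?_⟩
  have hdvd := returnTime_dvd_of_subset hF hn hE hn' hE' hE'E
  have hpos' := (returnTime_spec hF hn' hE').1
  refine lt_of_le_of_ne (Nat.le_of_dvd hpos' hdvd) fun heq => hyE' ?_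
  have h0 : phase F E y = 0 :=
    (phase_eq_iff hF hM hn hEM hE (hEM hy) (returnTime_spec hF hn hE).1).2 (by simpa using hy)
  have h1 := phase_mod_of_subset hF hM hn hEM hE hn' hE' hE'E (hEM hy)
  rw [heq, Nat.mod_eq_of_lt (phase_lt hF hM hn' hE'M hE' (hEM hy)), h0,
    phase_eq_iff hF hM hn' hE'M hE' (hEM hy) hpos'] at h1
  simpa using h1

/-- An infinite minimal set with trivial cluster points has a decreasing sequence of cells,
starting from the whole set, with strictly increasing return times and with the exponent `n i` of
the `i`-th cell divisible by `i`, for `i ≥ 1`. -/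
theorem exists_cell_sequence (hF : Continuous F) (hM : IsMinimalSet F M) (hinf : M.Infinite)
    (hsep : ∀ x ∈ M, ∀ y ∈ M, MapClusterPt y profiniteZero (fun k => F^[k] x) → y = x) :
    ∃ (n : ℕ → ℕ) (E : ℕ → Set Y), E 0 = M ∧ (∀ i, 1 ≤ n i) ∧ (∀ i, E i ⊆ M) ∧
      (∀ i, IsMinimalSet F^[n i] (E i)) ∧ (∀ i, E (i + 1) ⊆ E i) ∧
      (∀ i, returnTime F (E i) < returnTime F (E (i + 1))) ∧ ∀ i, i + 1 ∣ n (i + 1) := by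
  have hnext : ∀ (i : ℕ) (c : {c : ℕ × Set Y // 1 ≤ c.1 ∧ c.2 ⊆ M ∧ IsMinimalSet F^[c.1] c.2}),
      ∃ c' : {c : ℕ × Set Y // 1 ≤ c.1 ∧ c.2 ⊆ M ∧ IsMinimalSet F^[c.1] c.2},
        i + 1 ∣ c'.1.1 ∧ c'.1.2 ⊆ c.1.2 ∧ returnTime F c.1.2 < returnTime F c'.1.2 := by
    rintro i ⟨⟨n, E⟩, hn, hEM, hE⟩
    obtain ⟨n', E', hn', hdvd, hsub, hE', hlt⟩ :=
      exists_finer_cell hF hM hinf hsep hn hEM hE (Nat.succ_pos i)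
    exact ⟨⟨⟨n', E'⟩, hn', hsub.trans hEM, hE'⟩, hdvd, hsub, hlt⟩
  choose next hdvd hsub hlt using hnext
  obtain ⟨c, hc0, hc⟩ : ∃ c : ℕ → {c : ℕ × Set Y // 1 ≤ c.1 ∧ c.2 ⊆ M ∧ IsMinimalSet F^[c.1] c.2},
      (c 0).1.2 = M ∧ ∀ i, c (i + 1) = next i (c i) :=
    ⟨fun i => Nat.rec ⟨⟨1, M⟩, le_rfl, subset_rfl, hM⟩ next i, rfl, fun _ => rfl⟩
  refine ⟨fun i => (c i).1.1, fun i => (c i).1.2, hc0, fun i => (c i).2.1, fun i => (c i).2.2.1,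
    fun i => (c i).2.2.2, fun i => ?_, fun i => ?_, fun i => ?_⟩
  · simp only [hc]
    exact hsub i (c i)
  · simp only [hc]
    exact hlt i (c i)
  · simp only [hc]
    exact hdvd i (c i)

/-- An infinite minimal set `M` is an adding machine as soon as no point `x` of `M` has a cluster
point in `M` other than itself along `F^k(x)` as `k` tends to `0` profinitely. -/
theorem isAddingMachine_of_infinite (hF : Continuous F) (hM : IsMinimalSet F M)
    (hinf : M.Infinite)
    (hsep : ∀ x ∈ M, ∀ y ∈ M, MapClusterPt y profiniteZero (fun k => F^[k] x) → y = x) :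
    IsAddingMachine F M := by
  obtain ⟨n, E, hE0, hn, hEM, hE, hsub, hDlt, hdvd⟩ := exists_cell_sequence hF hM hinf hsep
  have hD0 : returnTime F (E 0) = 1 := Nat.dvd_one.1 <|
    (image_iterate_eq_self_iff hF (hn 0) (hE 0) 1).1 (hE0.symm ▸ hM.image_eq hF)
  have hDdvd : ∀ i, returnTime F (E i) ∣ returnTime F (E (i + 1)) := fun i =>
    returnTime_dvd_of_subset hF (hn i) (hE i) (hn (i + 1)) (hE (i + 1)) (hsub i)
  choose j hD using hDdvd
  have hj : ∀ i, 2 ≤ j i := by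
    intro i
    by_contra! hlt
    have h1 : returnTime F (E i) * j i ≤ returnTime F (E i) * 1 := Nat.mul_le_mul_left _ (by omega)
    have h2 := hDlt i
    rw [hD i] at h2
    omega
  have := isCompact_iff_compactSpace.1 hM.1.isClosed.isCompact
  have := hM.1.nonempty.to_subtype
  refine ⟨hM.1.isClosed, hM.1.mapsTo, j, hj, ?_⟩
  refine conjugate_addingMachine hj hD0 hD (fun i x => phase F (E i) x)
    (fun i x => phase_lt hF hM (hn i) (hEM i) (hE i) x.2)
    (fun i x => phase_map hF hM (hn i) (hEM i) (hE i) x.2)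
    (fun i x => phase_mod_of_subset hF hM (hn i) (hEM i) (hE i) (hn _) (hE _) (hsub i) x.2) ?_ ?_
  · intro i k
    rcases Nat.lt_or_ge k (returnTime F (E i)) with hk | hk
    · have heq : {x : M | phase F (E i) x = k} = Subtype.val ⁻¹' (F^[k] '' E i) := by
        ext x
        exact phase_eq_iff hF hM (hn i) (hEM i) (hE i) x.2 hk
      rw [heq]
      exact ((hE i).iterate_image hF k).1.isClosed.preimage continuous_subtype_val
    · convert isClosed_empty
      refine eq_empty_of_forall_notMem fun x hx => ?_
      have h1 : phase F (E i) x = k := hx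
      have h2 := phase_lt hF hM (hn i) (hEM i) (hE i) x.2
      exact absurd hk (not_le.2 (h1 ▸ h2))
  · intro x y hxy
    refine (Subtype.ext (hsep x x.2 y y.2 (mapClusterPt_profiniteZero_iff.2 ?_))).symm
    intro m hm
    obtain ⟨i, rfl⟩ := Nat.exists_eq_add_of_le' hm
    have hx := mem_image_phase hF hM (hn (i + 1)) (hEM _) (hE _) x.2
    have hy := mem_image_phase hF hM (hn (i + 1)) (hEM _) (hE _) y.2
    rw [← hxy] at hy
    refine closure_mono ?_ (((hE _).iterate_image hF _).subset_closure_iterate hF hx hy)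
    obtain ⟨q, hq⟩ := hdvd i
    rintro _ ⟨k, rfl⟩
    exact ⟨q * k, by simp only [hq, mul_assoc]⟩

end ProfiniteZero

/-! ### Minimal sets inside an `ω`-limit set -/

section OmegaLimit

variable {Y : Type*} [TopologicalSpace Y] {F : Y → Y}

theorem isClosedInvariant_omegaLimitSet [CompactSpace Y] (hF : Continuous F) (x : Y) :
    IsClosedInvariant F (omegaLimitSet F x) := by
  refine ⟨nonempty_omegaLimit _ _ _ (singleton_nonempty x), isClosed_omegaLimit _ _ _, ?_⟩
  rw [omegaLimitSet_eq_iInter]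
  intro z hz
  rw [mem_iInter] at hz ⊢
  refine fun n => map_mem_closure hF (hz n) ?_
  rintro _ ⟨k, hk, rfl⟩
  exact ⟨k + 1, by omega, Function.iterate_succ_apply' F k x⟩

theorem omegaLimitSet_subset_closure_orbit (x : Y) :
    omegaLimitSet F x ⊆ closure (range fun k => F^[k] x) := by
  rw [omegaLimitSet_eq_iInter]
  refine (iInter_subset _ 0).trans (closure_mono ?_)
  rintro _ ⟨k, -, rfl⟩
  exact ⟨k, rfl⟩

variable [CompactSpace Y] [T2Space Y]

theorem closure_orbit_subset_iUnion (hF : Continuous F) (x : Y) {n : ℕ} (hn : 1 ≤ n) :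
    closure (range fun k => F^[k] x) ⊆
      ⋃ j ∈ Iio n, F^[j] '' closure (range fun k => F^[n * k] x) := by
  refine closure_minimal ?_ ((finite_Iio n).isClosed_biUnion fun j _ =>
    (isClosed_closure.isCompact.image (hF.iterate j)).isClosed)
  rintro _ ⟨k, rfl⟩
  simp only [mem_iUnion, mem_Iio, exists_prop]
  refine ⟨k % n, Nat.mod_lt _ hn, _, subset_closure ⟨k / n, rfl⟩, ?_⟩
  rw [← Function.iterate_add_apply, Nat.mod_add_div]

/-- A minimal set in the `ω`-limit set of `x` contains a cluster point of `F^k(x)` as `k` tends to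
`0` profinitely. -/
theorem IsMinimalSet.exists_mapClusterPt (hF : Continuous F) {M : Set Y} (hM : IsMinimalSet F M)
    {x : Y} (hMx : M ⊆ omegaLimitSet F x) :
    ∃ y ∈ M, MapClusterPt y profiniteZero (fun k => F^[k] x) := by
  have hne : ∀ n, 1 ≤ n → (M ∩ closure (range fun k => F^[n * k] x)).Nonempty := by
    intro n hn
    obtain ⟨y, hy⟩ := hM.1.nonempty
    have h := closure_orbit_subset_iUnion hF x hn (omegaLimitSet_subset_closure_orbit x (hMx hy))
    simp only [mem_iUnion, mem_Iio, exists_prop] at h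
    obtain ⟨j, hj, z, hz, rfl⟩ := h
    refine ⟨F^[n - j] (F^[j] z), hM.1.mapsTo.iterate _ hy, ?_⟩
    rw [← Function.iterate_add_apply, Nat.sub_add_cancel hj.le]
    refine map_mem_closure (hF.iterate n) hz ?_
    rintro _ ⟨k, rfl⟩
    exact ⟨k + 1, by simp only [Nat.mul_succ, Nat.add_comm _ n, Function.iterate_add_apply]⟩
  obtain ⟨y, hy⟩ : (⋂ i : ℕ, M ∩ closure (range fun k => F^[i.factorial * k] x)).Nonempty := by
    refine IsCompact.nonempty_iInter_of_sequence_nonempty_isCompact_isClosed _ ?_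
      (fun i => hne _ i.factorial_pos) (hM.1.isClosed.inter isClosed_closure).isCompact
      (fun i => hM.1.isClosed.inter isClosed_closure)
    refine fun i => inter_subset_inter_right _ (closure_mono ?_)
    rintro _ ⟨k, rfl⟩
    exact ⟨(i + 1) * k, by simp only [Nat.factorial_succ]; ring_nf⟩
  rw [mem_iInter] at hy
  refine ⟨y, (hy 0).1, mapClusterPt_profiniteZero_iff.2 fun n hn => closure_mono ?_ (hy n).2⟩
  obtain ⟨q, hq⟩ := Nat.dvd_factorial hn le_rfl
  rintro _ ⟨k, rfl⟩
  exact ⟨q * k, by simp only [hq, mul_assoc]⟩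

omit [CompactSpace Y] in
theorem omegaLimitSet_finite_of_iterate_eq {p : ℕ} (hp : 1 ≤ p) {x : Y} (h : F^[p] x = x) :
    (omegaLimitSet F x).Finite := by
  have hfin : (range fun k => F^[k] x).Finite := by
    refine ((finite_Iio p).image fun k => F^[k] x).subset ?_
    rintro _ ⟨k, rfl⟩
    refine ⟨k % p, Nat.mod_lt _ hp, ?_⟩
    exact Function.IsPeriodicPt.iterate_mod_apply (f := F) (n := p) h k
  exact hfin.subset ((omegaLimitSet_subset_closure_orbit x).trans hfin.isClosed.closure_subset)

end OmegaLimit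

/-! ### The map induced on the hyperspace by a pointwise periodic homeomorphism -/

section Hyperspace

variable {X : Type*} [MetricSpace X]

theorem coe_inducedMap_iterate {f : X → X} (hf : Continuous f) (k : ℕ) (A : NonemptyCompacts X) :
    ((inducedMap f hf)^[k] A : Set X) = f^[k] '' A := by
  induction k with
  | zero => simp
  | succ k ih =>
    rw [Function.iterate_succ_apply', inducedMap, NonemptyCompacts.coe_map, ← inducedMap, ih,
      Function.iterate_succ', image_comp]

theorem continuous_inducedMap {f : X → X} (hf : Continuous f) : Continuous (inducedMap f hf) :=
  hf.nonemptyCompacts_map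

theorem inducedMap_injective (f : X ≃ₜ X) :
    Function.Injective (inducedMap f f.continuous) := fun _ _ h =>
  NonemptyCompacts.ext <| f.injective.image_injective <|
    congrArg (fun C : NonemptyCompacts X => (C : Set X)) h

/-- A point of `A` of period `n` belongs to `f^k(A)` for all multiples `k` of `n`, so `A` lies in
every cluster point of `f^k(A)` as `k` tends to `0` profinitely. -/
theorem PointwisePeriodic.le_of_mapClusterPt {f : X → X} (hf : Continuous f)
    (hper : PointwisePeriodic f) {A B : NonemptyCompacts X}
    (h : MapClusterPt B profiniteZero (fun k => (inducedMap f hf)^[k] A)) : A ≤ B := by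
  intro p hp
  obtain ⟨n, hn, hpn⟩ := hper p
  have hev : ∀ᶠ k in profiniteZero, (inducedMap f hf)^[k] A ∈
      {C : NonemptyCompacts X | ((C : Set X) ∩ {p}).Nonempty} := by
    filter_upwards [eventually_dvd_profiniteZero (Nat.succ_le_of_lt hn)] with k hk
    refine ⟨p, ?_, rfl⟩
    rw [coe_inducedMap_iterate]
    exact ⟨p, hp, hpn.trans_dvd hk⟩
  obtain ⟨q, hqB, rfl⟩ := (NonemptyCompacts.isClosed_inter_nonempty_of_isClosed
    (isClosed_singleton (x := p))).mem_of_mapClusterPt h hev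
  exact hqB

/-- In a minimal set of the hyperspace, a cluster point of `f^k(A)` as `k` tends to `0` profinitely
contains `A`, and by symmetry is contained in `A`. -/
theorem IsMinimalSet.eq_of_mapClusterPt [CompactSpace X] {f : X → X} (hf : Continuous f)
    (hper : PointwisePeriodic f) {M : Set (NonemptyCompacts X)}
    (hM : IsMinimalSet (inducedMap f hf) M) {A B : NonemptyCompacts X} (hA : A ∈ M)
    (h : MapClusterPt B profiniteZero (fun k => (inducedMap f hf)^[k] A)) : B = A :=
  (hper.le_of_mapClusterPt hf
    (hM.mapClusterPt_symm (continuous_inducedMap hf) hA h).2).antisymm (hper.le_of_mapClusterPt hf h)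

/-- The element `B` of a minimal set satisfies `f^k(B) → B` as `k` tends to `0` profinitely. If
`A ⊆ B`, it therefore contains all cluster points of `f^k(A)`. -/
theorem IsMinimalSet.le_of_mapClusterPt_of_le [CompactSpace X] {f : X → X} (hf : Continuous f)
    (hper : PointwisePeriodic f) {M : Set (NonemptyCompacts X)}
    (hM : IsMinimalSet (inducedMap f hf) M) {A B C : NonemptyCompacts X} (hB : B ∈ M)
    (hAB : A ≤ B) (h : MapClusterPt C profiniteZero (fun k => (inducedMap f hf)^[k] A)) :
    C ≤ B := by
  have hlim : Tendsto (fun k => (inducedMap f hf)^[k] B) profiniteZero (𝓝 B) :=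
    isCompact_univ.tendsto_nhds_of_unique_mapClusterPt (by simp) fun D _ hD =>
      hM.eq_of_mapClusterPt hf hper hB hD
  intro p hpC
  by_contra hpB
  obtain ⟨U, V, hU, hV, hpU, hBV, hUV⟩ := SeparatedNhds.of_isCompact_isCompact
    (isCompact_singleton (x := p)) B.isCompact (disjoint_singleton_left.2 hpB)
  have hfreq := h.frequently ((NonemptyCompacts.isOpen_inter_nonempty_of_isOpen hU).mem_nhds
    (show ((C : Set X) ∩ U).Nonempty from ⟨p, hpC, hpU rfl⟩))
  have hev := hlim.eventually_mem ((NonemptyCompacts.isOpen_subsets_of_isOpen hV).mem_nhds hBV)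
  obtain ⟨k, ⟨q, hqA, hqU⟩, hkB⟩ := (hfreq.and_eventually hev).exists
  refine disjoint_left.1 hUV hqU (hkB ?_)
  change q ∈ ((inducedMap f hf)^[k] A : Set X) at hqA
  rw [coe_inducedMap_iterate] at hqA ⊢
  exact image_mono hAB hqA

/-- Let `B` be a cluster point of `f^k(A)` as `k` tends to `0` profinitely, and suppose that
`f^p(B) = B`. By the Baire category theorem, `B` has a dense open subset near each point of which
some `f^n` is the identity on `B`. For some `k` divisible by both `n` and `p`, the set
`f^k(A) ⊆ B` meets such a neighbourhood, in points fixed by `f^n` and so lying in `A`. Hence `A` is dense in `B`. -/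
theorem PointwisePeriodic.eq_of_mapClusterPt_of_iterate_eq [CompactSpace X] (f : X ≃ₜ X)
    (hper : PointwisePeriodic f) {A B : NonemptyCompacts X} {p : ℕ} (hp : 1 ≤ p)
    (hB : (inducedMap f f.continuous)^[p] B = B)
    (h : MapClusterPt B profiniteZero (fun k => (inducedMap f f.continuous)^[k] A)) :
    A = B := by
  have hAB : A ≤ B := hper.le_of_mapClusterPt f.continuous h
  refine hAB.antisymm fun b hb => ?_
  rw [← SetLike.mem_coe, ← A.isCompact.isClosed.closure_eq, mem_closure_iff]
  intro U hU hbU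
  have : CompactSpace B := isCompact_iff_compactSpace.1 B.isCompact
  let P : ℕ → Set B := fun n => {x | f^[n + 1] x = x}
  have hP : ∀ n, IsClosed (P n) := fun n =>
    isClosed_eq ((f.continuous.iterate _).comp continuous_subtype_val) continuous_subtype_val
  have hPU : ⋃ n, P n = univ := by
    refine eq_univ_of_forall fun x => mem_iUnion.2 ?_
    obtain ⟨n, hn, hx⟩ := hper (x : X)
    obtain ⟨m, rfl⟩ := Nat.exists_eq_add_of_le' (Nat.succ_le_of_lt hn)
    exact ⟨m, hx⟩
  obtain ⟨x, hxU, hxP⟩ := (dense_iUnion_interior_of_closed hP hPU).inter_open_nonempty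
    (Subtype.val ⁻¹' U) (hU.preimage continuous_subtype_val) ⟨⟨b, hb⟩, hbU⟩
  obtain ⟨n, hxn⟩ := mem_iUnion.1 hxP
  obtain ⟨V, hV, hVP⟩ := isOpen_induced_iff.1 (isOpen_interior (s := P n))
  have hxV : (x : X) ∈ V := by
    change x ∈ Subtype.val ⁻¹' V
    rwa [hVP]
  have hfreq := h.frequently
    ((NonemptyCompacts.isOpen_inter_nonempty_of_isOpen (hU.inter hV)).mem_nhds
      (show ((B : Set X) ∩ (U ∩ V)).Nonempty from ⟨x, x.2, hxU, hxV⟩))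
  obtain ⟨k, ⟨y, hyA, hyU, hyV⟩, hkn, hkp⟩ := (hfreq.and_eventually
    ((eventually_dvd_profiniteZero (Nat.succ_pos n)).and (eventually_dvd_profiniteZero hp))).exists
  change y ∈ ((inducedMap f f.continuous)^[k] A : Set X) at hyA
  have hBk : (inducedMap f f.continuous)^[k] B = B :=
    Function.IsPeriodicPt.trans_dvd (f := inducedMap f f.continuous) hB hkp
  rw [coe_inducedMap_iterate] at hyA
  have hyB : y ∈ B := by
    rw [← SetLike.mem_coe, ← hBk, coe_inducedMap_iterate]
    exact image_mono hAB hyA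
  obtain ⟨a, ha, rfl⟩ := hyA
  have hfix : f^[n + 1] (f^[k] a) = f^[k] a := by
    have hmem : (⟨f^[k] a, hyB⟩ : B) ∈ interior (P n) := by
      rw [← hVP]
      exact hyV
    have hmemP : (⟨f^[k] a, hyB⟩ : B) ∈ P n := interior_subset hmem
    exact hmemP
  have hfixk : f^[k] (f^[k] a) = f^[k] a :=
    Function.IsPeriodicPt.trans_dvd (f := f) hfix hkn
  rw [f.injective.iterate k hfixk] at hyU
  exact ⟨a, hyU, ha⟩

end Hyperspace

end HyperspaceDynamics

theorem theorem5p1 {X : Type*} [MetricSpace X] [CompactSpace X] (f : X ≃ₜ X)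
    (hf : HyperspaceDynamics.PointwisePeriodic f) (A : NonemptyCompacts X) :
    ∃ M : Set (NonemptyCompacts X),
      -- `M` is the unique minimal set contained in the `ω`-limit set of `A`
      ((HyperspaceDynamics.IsMinimalSet (HyperspaceDynamics.inducedMap f f.continuous) M ∧
          M ⊆ HyperspaceDynamics.omegaLimitSet
            (HyperspaceDynamics.inducedMap f f.continuous) A) ∧
        ∀ M' : Set (NonemptyCompacts X),
          HyperspaceDynamics.IsMinimalSet (HyperspaceDynamics.inducedMap f f.continuous) M' →
          M' ⊆ HyperspaceDynamics.omegaLimitSet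
            (HyperspaceDynamics.inducedMap f f.continuous) A →
          M' = M) ∧
      ((HyperspaceDynamics.omegaLimitSet
          (HyperspaceDynamics.inducedMap f f.continuous) A).Finite ↔ M.Finite) ∧
      ((HyperspaceDynamics.omegaLimitSet
          (HyperspaceDynamics.inducedMap f f.continuous) A).Infinite →
        HyperspaceDynamics.IsAddingMachine
          (HyperspaceDynamics.inducedMap f f.continuous) M) := by
  open HyperspaceDynamics in
  have hF : Continuous (inducedMap f f.continuous) := continuous_inducedMap f.continuous
  obtain ⟨M, hMA, hM⟩ := (isClosedInvariant_omegaLimitSet hF A).exists_isMinimalSet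
  obtain ⟨B, hBM, hB⟩ := hM.exists_mapClusterPt hF hMA
  have hAB := hf.le_of_mapClusterPt f.continuous hB
  have hfin : M.Finite → (omegaLimitSet (inducedMap f f.continuous) A).Finite := by
    intro hMfin
    obtain ⟨i, k, hik, heq⟩ := hMfin.exists_lt_map_eq_of_forall_mem
      (f := fun k => (inducedMap f f.continuous)^[k] B) fun k => hM.1.mapsTo.iterate k hBM
    have hper : (inducedMap f f.continuous)^[k - i] B = B := by
      refine ((inducedMap_injective f).iterate i ?_).symm
      rw [← Function.iterate_add_apply, Nat.add_sub_cancel' hik.le]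
      exact heq
    have hpos : 1 ≤ k - i := by omega
    refine omegaLimitSet_finite_of_iterate_eq hpos ?_
    rwa [hf.eq_of_mapClusterPt_of_iterate_eq f hpos hper hB]
  refine ⟨M, ⟨⟨hM, hMA⟩, fun M' hM' hMA' => ?_⟩, ⟨fun h => h.subset hMA, hfin⟩, fun hinf => ?_⟩
  · obtain ⟨B', hBM', hB'⟩ := hM'.exists_mapClusterPt hF hMA'
    have hAB' := hf.le_of_mapClusterPt f.continuous hB'
    have heq : B' = B := (hM.le_of_mapClusterPt_of_le f.continuous hf hBM hAB hB').antisymm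
      (hM'.le_of_mapClusterPt_of_le f.continuous hf hBM' hAB' hB)
    exact hM'.eq_of_mem hM (heq ▸ hBM') hBM
  · exact isAddingMachine_of_infinite hF hM (fun h => hinf (hfin h)) fun x hx y _ h =>
      hM.eq_of_mapClusterPt f.continuous hf hx h
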